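/- Let $k\ge 0$ be an integer and let $\Omega\subset\mathbb{R}$ be a nonempty open set. Write $\mathscr{C}^k(\Omega)$ for the set of $k$ times continuously differentiable functions $f\colon\Omega\to\mathbb{R}$ and $\mathscr{C}(\Omega)=\mathscr{C}^0(\Omega)$. For a (not necessarily linear) operator $D$ with values in $\mathscr{C}(\Omega)$ consider the identity $$D(fgh)-fD(gh)-gD(fh)-hD(fg)+fg\,D(h)+fh\,D(g)+gh\,D(f)=0.\qquad(*)$$ 1. Suppose that $D\colon\mathscr{C}^k(\Omega)\to\mathscr{C}(\Omega)$ satisfies $(*)$ for all $f,g,h\in\mathscr{C}^k(\Omega)$. Then there are functions $c_i,d_{i,j}\in\mathscr{C}(\Omega)$ $(i,j=0,\ldots,k)$ such that for every positive function $f\in\mathscr{C}^k(\Omega)$ and every $x\in\Omega$ $$D(f)(x)=f(x)\cdot\left[\sum_{i=0}^k c_i(x)(\ln\circ f)^{(i)}(x)+\sum_{i=0}^k\sum_{j=0}^k d_{i,j}(x)(\ln\circ f)^{(i)}(x)(\ln\circ f)^{(j)}(x)\right].\qquad(**)$$ 2. Conversely, for arbitrary functions $c_i,d_{i,j}\in\mathscr{C}(\Omega)$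 $(i,j=0,\ldots,k)$, formula $(**)$ defines an operator $D$ from the set of positive functions of $\mathscr{C}^k(\Omega)$ to $\mathscr{C}(\Omega)$, and this operator satisfies $(*)$ for all positive $f,g,h\in\mathscr{C}^k(\Omega)$. -/

import Mathlib

/-- Extension by zero to the whole line of a real function given on a set `Ω ⊆ ℝ`. -/
noncomputable def extendZero (Ω : Set ℝ) (u : Ω → ℝ) : ℝ → ℝ :=
  Function.extend Subtype.val u 0

theorem extendZero_apply (Ω : Set ℝ) (u : Ω → ℝ) (x : Ω) : extendZero Ω u x = u x :=
  Subtype.val_injective.extend_apply u 0 x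

/-- The algebra `𝒞ᵏ(Ω)` of `k` times continuously differentiable functions `f : Ω → ℝ`
(for open `Ω ⊆ ℝ`), with the pointwise operations. -/
noncomputable def CkSpace (k : ℕ) (Ω : Set ℝ) : Subalgebra ℝ (Ω → ℝ) where
  carrier := {f | ContDiffOn ℝ (k : WithTop ℕ∞) (extendZero Ω f) Ω}
  mul_mem' {f g} hf hg := by
    refine (ContDiffOn.mul hf hg).congr fun x hx => ?_
    have h := fun u => extendZero_apply Ω u ⟨x, hx⟩
    simp only at h
    simp [h]
  add_mem' {f g} hf hg := by
    refine (ContDiffOn.add hf hg).congr fun x hx => ?_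
    have h := fun u => extendZero_apply Ω u ⟨x, hx⟩
    simp only at h
    simp [h]
  algebraMap_mem' r := by
    refine (contDiffOn_const (c := r)).congr fun x hx => ?_
    have h := fun u => extendZero_apply Ω u ⟨x, hx⟩
    simp only at h
    simp [h]

/-- The positive functions of `𝒞ᵏ(Ω)`; they are closed under multiplication. -/
noncomputable def CkPos (k : ℕ) (Ω : Set ℝ) : Submonoid (CkSpace k Ω) where
  carrier := {f | ∀ x : Ω, 0 < f.1 x}
  mul_mem' {f g} hf hg := fun x => mul_pos (hf x) (hg x)
  one_mem' := fun _ => one_pos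

/-- The `i`-th derivative at `x ∈ Ω` of a function `u : Ω → ℝ`, for open `Ω ⊆ ℝ`. -/
noncomputable def derivOrder (Ω : Set ℝ) (i : ℕ) (u : Ω → ℝ) (x : Ω) : ℝ :=
  iteratedDerivWithin i (extendZero Ω u) Ω x

/-- The operator identity
`D(fgh) - f D(gh) - g D(fh) - h D(fg) + fg D(h) + fh D(g) + gh D(f) = 0`
for all `f, g, h ∈ 𝒞ᵏ(Ω)`. -/
def SatisfiesIdTwo {k : ℕ} {Ω : Set ℝ} (D : CkSpace k Ω → C(Ω, ℝ)) : Prop :=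
  ∀ (f g h : CkSpace k Ω) (x : Ω),
    D (f * g * h) x - f.1 x * D (g * h) x - g.1 x * D (f * h) x - h.1 x * D (f * g) x
      + f.1 x * g.1 x * D h x + f.1 x * h.1 x * D g x + g.1 x * h.1 x * D f x = 0

/-- The same identity for an operator given on the positive functions of `𝒞ᵏ(Ω)`, required for
all positive `f, g, h`. -/
def SatisfiesIdTwoPos {k : ℕ} {Ω : Set ℝ} (D : CkPos k Ω → C(Ω, ℝ)) : Prop :=
  ∀ (f g h : CkPos k Ω) (x : Ω),
    D (f * g * h) x - f.1.1 x * D (g * h) x - g.1.1 x * D (f * h) x - h.1.1 x * D (f * g) x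
      + f.1.1 x * g.1.1 x * D h x + f.1.1 x * h.1.1 x * D g x + g.1.1 x * h.1.1 x * D f x = 0

/-- The expression
`f(x) [∑ᵢ cᵢ(x) (ln ∘ f)⁽ⁱ⁾(x) + ∑ᵢ ∑ⱼ dᵢⱼ(x) (ln ∘ f)⁽ⁱ⁾(x) (ln ∘ f)⁽ʲ⁾(x)]`,
with `i, j` running over `0, …, k`. -/
noncomputable def logForm {k : ℕ} {Ω : Set ℝ} (c : Fin (k + 1) → C(Ω, ℝ))
    (d : Fin (k + 1) → Fin (k + 1) → C(Ω, ℝ)) (f : Ω → ℝ) (x : Ω) : ℝ :=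
  f x * (∑ i : Fin (k + 1), c i x * derivOrder Ω i (fun y => Real.log (f y)) x
    + ∑ i : Fin (k + 1), ∑ j : Fin (k + 1), d i j x
        * derivOrder Ω i (fun y => Real.log (f y)) x
        * derivOrder Ω j (fun y => Real.log (f y)) x)

open Filter Topology Set

/-! On positive functions put `A u = e⁻ᵘ D(eᵘ)`. The identity says that the third-order differences
of `A` at the origin vanish, so `A u = L u + Q u u` with `L` additive and `Q` biadditive and
symmetric. Testing the identity against bump functions makes `D`, hence `L` and `Q` in each
variable, local.

An additive local operator with continuous values is a differential operator of order at most `k`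
(`IsLocalOp.eq_sum_derivOrder`): it sees only the `k`-jet (`IsLocalOp.eq_of_jet_eq_zero`), and a
gliding hump makes it homogeneous (`IsLocalOp.homogeneous`), so it can be evaluated on Taylor
polynomials. Applied to `L`, and to `Q` in one variable and then the other, this gives the formula.
Conversely, logarithms turn products into sums, and third differences of a quadratic form plus a
linear one vanish. -/

theorem extendZero_eqOn {Ω : Set ℝ} (φ : ℝ → ℝ) :
    EqOn (extendZero Ω fun y => φ y) φ Ω :=
  fun y hy => extendZero_apply Ω (fun y => φ y) ⟨y, hy⟩

/-- The restriction to `Ω` of a function that is `k` times continuously differentiable on `Ω`. -/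
noncomputable def CkSpace.ofReal (k : ℕ) (Ω : Set ℝ) (φ : ℝ → ℝ) (hφ : ContDiffOn ℝ k φ Ω) :
    CkSpace k Ω :=
  ⟨fun y => φ y, hφ.congr fun _ hy => extendZero_eqOn φ hy⟩

@[simp]
theorem CkSpace.ofReal_apply {k : ℕ} {Ω : Set ℝ} {φ : ℝ → ℝ} (hφ : ContDiffOn ℝ k φ Ω) (y : Ω) :
    (CkSpace.ofReal k Ω φ hφ).1 y = φ y := rfl

/-! ### Locality and dependence on the `k`-jet. -/

/-- A function all of whose derivatives of order at most `n` vanish at `a` stays of class `𝒞ⁿ`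
when it is replaced by zero to the left of `a`. -/
theorem contDiffOn_indicator_Ici {Ω : Set ℝ} (hΩ : IsOpen Ω) {a : ℝ} (ha : a ∈ Ω) (n : ℕ) :
    ∀ {f : ℝ → ℝ}, ContDiffOn ℝ n f Ω → (∀ i ≤ n, iteratedDeriv i f a = 0) →
      ContDiffOn ℝ n ((Ici a).indicator f) Ω := by
  induction n with
  | zero =>
    intro f hf h0
    have hfa : f a = 0 := by simpa using h0 0 le_rfl
    rw [Nat.cast_zero, contDiffOn_zero] at hf ⊢
    refine ContinuousOn.piecewise (t := Ici a) (fun y hy => ?_) (hf.mono inter_subset_left)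
      continuousOn_const
    have : y = a := by simpa using hy.2
    rw [this, hfa]
  | succ n ih =>
    intro f hf h0
    have hfa : f a = 0 := by simpa using h0 0 (Nat.zero_le _)
    have hfa' : deriv f a = 0 := by simpa using h0 1 (by omega)
    rw [Nat.cast_add, Nat.cast_one, contDiffOn_succ_iff_deriv_of_isOpen hΩ] at hf
    have key : ∀ y ∈ Ω, HasDerivAt ((Ici a).indicator f) ((Ici a).indicator (deriv f) y) y := by
      intro y hy
      have hd : HasDerivAt f (deriv f y) y := (hf.1.differentiableAt (hΩ.mem_nhds hy)).hasDerivAt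
      rcases lt_trichotomy y a with h | rfl | h
      · rw [indicator_of_notMem (by simpa using h)]
        refine (hasDerivAt_const y (0 : ℝ)).congr_of_eventuallyEq ?_
        filter_upwards [Iio_mem_nhds h] with z hz
        exact indicator_of_notMem (by simpa using hz) f
      · rw [hfa'] at hd
        simp only [mem_Ici, le_refl, indicator_of_mem, hfa']
        rw [hasDerivAt_iff_isLittleO] at hd ⊢
        -- At the junction the truncation is dominated by `f`, which is itself little-o there.
        refine (Asymptotics.IsBigO.of_bound 1 (Eventually.of_forall fun z => ?_)).trans_isLittleO hd
        by_cases hz : z ∈ Ici y <;> simp [hz, hfa]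
      · rw [indicator_of_mem (by simpa using h.le)]
        refine hd.congr_of_eventuallyEq ?_
        filter_upwards [Ioi_mem_nhds h] with z hz
        exact indicator_of_mem (by simpa using hz.le) f
    rw [Nat.cast_add, Nat.cast_one, contDiffOn_succ_iff_deriv_of_isOpen hΩ]
    refine ⟨fun y hy => (key y hy).differentiableAt.differentiableWithinAt, by simp, ?_⟩
    refine (ih hf.2.2 fun i hi => ?_).congr fun y hy => (key y hy).deriv
    rw [← iteratedDeriv_succ']
    exact h0 _ (by omega)

/-- An operator on `𝒞ᵏ(Ω)` is local if its value near a point depends only on the function near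
that point. -/
def IsLocalOp {k : ℕ} {Ω : Set ℝ} (L : CkSpace k Ω → C(Ω, ℝ)) : Prop :=
  ∀ (u v : CkSpace k Ω) (x : Ω), (∀ᶠ y in 𝓝 x, u.1 y = v.1 y) → L u x = L v x

theorem mem_closure_of_val {Ω : Set ℝ} (hΩ : IsOpen Ω) {s : Set ℝ} {x : Ω}
    (hx : (x : ℝ) ∈ closure s) : x ∈ closure (Subtype.val ⁻¹' s : Set Ω) := by
  rw [← hΩ.isOpenMap_subtype_val.preimage_closure_eq_closure_preimage continuous_subtype_val]
  exact hx

/-- A local operator with continuous values depends at each point only on the `k`-jet of the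
function; here for functions whose `k`-jet vanishes. -/
theorem IsLocalOp.eq_of_jet_eq_zero {k : ℕ} {Ω : Set ℝ} (hΩ : IsOpen Ω)
    {L : CkSpace k Ω → C(Ω, ℝ)} (hL : IsLocalOp L) (u : CkSpace k Ω) (x : Ω)
    (hu : ∀ i ≤ k, derivOrder Ω i u.1 x = 0) : L u x = L 0 x := by
  -- `w` agrees with `u` to the right of `x` and with zero to the left; continuity of the values of
  -- `L` at `x` links all three.
  let w : CkSpace k Ω := CkSpace.ofReal k Ω ((Ici (x : ℝ)).indicator (extendZero Ω u.1))
    (contDiffOn_indicator_Ici hΩ x.2 k u.2 fun i hi => by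
      rw [← iteratedDerivWithin_of_isOpen hΩ x.2]; exact hu i hi)
  have closed_eq : ∀ (F G : C(Ω, ℝ)) (s : Set ℝ), (x : ℝ) ∈ closure s →
      (∀ y : Ω, (y : ℝ) ∈ s → F y = G y) → F x = G x := fun F G s hx h =>
    (closure_minimal (fun y hy => h y hy) (isClosed_eq F.continuous G.continuous) :
      closure (Subtype.val ⁻¹' s : Set Ω) ⊆ {y | F y = G y}) (mem_closure_of_val hΩ hx)
  have hright : L u x = L w x := by
    refine closed_eq _ _ (Ioi (x : ℝ)) (by simp) fun y hy => hL _ _ _ ?_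
    filter_upwards [continuous_subtype_val.continuousAt.preimage_mem_nhds (Ioi_mem_nhds hy)]
      with z hz
    have hz' : (z : ℝ) ∈ Ici (x : ℝ) := mem_Ici.2 (le_of_lt hz)
    simp only [w, CkSpace.ofReal_apply, indicator_of_mem hz', extendZero_apply]
  have hleft : L w x = L 0 x := by
    refine closed_eq _ _ (Iio (x : ℝ)) (by simp) fun y hy => hL _ _ _ ?_
    filter_upwards [continuous_subtype_val.continuousAt.preimage_mem_nhds (Iio_mem_nhds hy)]
      with z hz
    have hz' : (z : ℝ) ∉ Ici (x : ℝ) := notMem_Ici.2 hz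
    simp only [w, CkSpace.ofReal_apply, indicator_of_notMem hz']
    rfl
  exact hright.trans hleft

/-! ### Homogeneity by a gliding hump. -/

/-- An additive function on the line that is not homogeneous is unbounded near zero. -/
theorem AddMonoidHom.exists_small_of_not_homogeneous (φ : ℝ →+ ℝ) {r : ℝ} (hr : φ r ≠ r * φ 1)
    {ε : ℝ} (hε : 0 < ε) (M : ℝ) : ∃ a, |a| < ε ∧ M < |φ a| := by
  by_contra! h
  have hc : Continuous φ := by
    refine φ.continuous_of_isBounded_nhds_zero (Metric.ball_mem_nhds 0 hε) ?_
    refine (Metric.isBounded_closedBall (x := (0 : ℝ)) (r := M)).subset ?_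
    rintro _ ⟨a, ha, rfl⟩
    simpa using h a (by simpa using ha)
  have := map_real_smul φ hc r 1
  simp only [smul_eq_mul, mul_one] at this
  exact hr this

/-- For compactly supported functions of class `𝒞ᵏ`, all sufficiently small weights make the
weighted sum of class `𝒞ᵏ`. -/
theorem exists_weights_contDiff_tsum (k : ℕ) (χ : ℕ → ℝ → ℝ) (hχ : ∀ n, ContDiff ℝ k (χ n))
    (hs : ∀ n, HasCompactSupport (χ n)) :
    ∃ ε : ℕ → ℝ, (∀ n, 0 < ε n) ∧ ∀ r : ℕ → ℝ, (∀ n, |r n| < ε n) →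
      ContDiff ℝ k fun y => ∑' n, r n * χ n y := by
  have hb : ∀ n (i : ℕ), ∃ C : ℝ, i ≤ k → ∀ y, ‖iteratedFDeriv ℝ i (χ n) y‖ ≤ C := by
    intro n i
    by_cases hi : i ≤ k
    · obtain ⟨C, hC⟩ := ((hs n).iteratedFDeriv (𝕜 := ℝ) i).exists_bound_of_continuous
        ((hχ n).continuous_iteratedFDeriv (by exact_mod_cast hi))
      exact ⟨C, fun _ => hC⟩
    · exact ⟨0, fun h => absurd h hi⟩
  choose C hC using hb
  let B : ℕ → ℝ := fun n => ∑ i ∈ Finset.range (k + 1), |C n i|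
  have hB : ∀ n, 0 ≤ B n := fun n => Finset.sum_nonneg fun i _ => abs_nonneg _
  -- `B n` bounds all derivatives of `χ n` up to order `k`, so a geometric series dominates each
  -- differentiated sum.
  refine ⟨fun n => (1 / 2) ^ n / (B n + 1), fun n => by have := hB n; positivity, fun r hr => ?_⟩
  refine contDiff_tsum (N := (k : ℕ∞)) (v := fun _ n => (1 / 2 : ℝ) ^ n)
    (fun n => contDiff_const.mul (hχ n)) (fun _ _ => summable_geometric_two) ?_
  intro i n y hi
  have hi' : i ≤ k := by exact_mod_cast hi
  have h1 : iteratedFDeriv ℝ i (fun y => r n * χ n y) y = r n • iteratedFDeriv ℝ i (χ n) y :=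
    iteratedFDeriv_const_smul_apply (a := r n) (((hχ n).of_le (by exact_mod_cast hi')).contDiffAt)
  rw [h1, norm_smul, Real.norm_eq_abs]
  have h2 : ‖iteratedFDeriv ℝ i (χ n) y‖ ≤ B n + 1 := by
    have := Finset.single_le_sum (f := fun i => |C n i|) (fun i _ => abs_nonneg _)
      (Finset.mem_range.2 (Nat.lt_succ_of_le hi'))
    have h3 := hC n i hi' y
    have h4 := le_abs_self (C n i)
    simp only [B]
    linarith
  have hp : 0 < B n + 1 := by have := hB n; linarith
  calc |r n| * ‖iteratedFDeriv ℝ i (χ n) y‖ ≤ (1 / 2) ^ n / (B n + 1) * (B n + 1) := by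
        gcongr; exact (hr n).le
    _ = (1 / 2) ^ n := by field_simp

/-- An additive local operator with continuous values is homogeneous. -/
theorem IsLocalOp.homogeneous {k : ℕ} {Ω : Set ℝ} (hΩ : IsOpen Ω) (L : CkSpace k Ω →+ C(Ω, ℝ))
    (hL : IsLocalOp L) (r : ℝ) (p : CkSpace k Ω) (x : Ω) : L (r • p) x = r * L p x := by
  -- A failure at `x` persists nearby. At points `ξ n → x` there are tiny `a n` with `|L (a n • p)
  -- (ξ n)| > n`; one function `w` equal to `a n • p` near each `ξ n` then has `L w` unbounded near
  -- `x`.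
  by_contra hne
  have hU : ∀ᶠ y : Ω in 𝓝 x, L (r • p) y ≠ r * L p y :=
    (isOpen_ne_fun (L (r • p)).continuous (continuous_const.mul (L p).continuous)).mem_nhds hne
  obtain ⟨δ₁, hδ₁, h₁⟩ := Metric.eventually_nhds_iff.1 hU
  obtain ⟨δ₂, hδ₂, h₂⟩ := Metric.isOpen_iff.1 hΩ x x.2
  obtain ⟨δ, hδ, hδ1, hδ2⟩ : ∃ δ, 0 < δ ∧ δ ≤ δ₁ ∧ δ ≤ δ₂ :=
    ⟨min δ₁ δ₂, lt_min hδ₁ hδ₂, min_le_left _ _, min_le_right _ _⟩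
  let q : ℕ → ℝ := fun n => δ * (1 / 2) ^ (n + 1)
  have hq : ∀ n, 0 < q n := fun n => by positivity
  have hqδ : ∀ n, q n < δ := fun n =>
    mul_lt_of_lt_one_right hδ (pow_lt_one₀ (by norm_num) (by norm_num) (Nat.succ_ne_zero n))
  have hqlt : ∀ {m n}, m < n → q n ≤ q m / 2 := by
    intro m n hmn
    have : (1 / 2 : ℝ) ^ (n + 1) ≤ (1 / 2) ^ (m + 1 + 1) :=
      pow_le_pow_of_le_one (by norm_num) (by norm_num) (by omega)
    calc q n ≤ δ * (1 / 2) ^ (m + 1 + 1) := mul_le_mul_of_nonneg_left this hδ.le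
      _ = q m / 2 := by simp only [q]; ring
  have hq0 : Tendsto q atTop (𝓝 0) := by
    have := (tendsto_pow_atTop_nhds_zero_of_lt_one (r := (1 / 2 : ℝ)) (by norm_num)
      (by norm_num)).comp (tendsto_add_atTop_nat 1)
    simpa [q, Function.comp_def] using this.const_mul δ
  let ξ : ℕ → Ω := fun n => ⟨x + q n, h₂ (by
    rw [Metric.mem_ball, Real.dist_eq, add_sub_cancel_left, abs_of_pos (hq n)]
    exact (hqδ n).trans_le hδ2)⟩
  have hξ : Tendsto ξ atTop (𝓝 x) := by
    rw [tendsto_subtype_rng]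
    simpa [ξ] using hq0.const_add (x : ℝ)
  have hξne : ∀ n, L (r • p) (ξ n) ≠ r * L p (ξ n) := fun n => h₁ (by
    rw [Subtype.dist_eq, Real.dist_eq]
    simp only [ξ, add_sub_cancel_left, abs_of_pos (hq n)]
    exact (hqδ n).trans_le hδ1)
  -- Since `q` at least halves at each step, the bump at `x + q m` vanishes within `q n / 8` of `x +
  -- q n` for `m ≠ n`.
  let χ : ∀ n, ContDiffBump (x + q n : ℝ) := fun n =>
    ⟨q n / 8, q n / 4, by have := hq n; positivity, by linarith [hq n]⟩
  obtain ⟨ε, hε, hsum⟩ := exists_weights_contDiff_tsum k (fun n => χ n)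
    (fun n => (χ n).contDiff) fun n => (χ n).hasCompactSupport
  let φ : ℕ → ℝ →+ ℝ := fun n => AddMonoidHom.mk' (fun a => L (a • p) (ξ n)) fun a b => by
    rw [add_smul, map_add, ContinuousMap.add_apply]
  have hφ : ∀ n, φ n r ≠ r * φ n 1 := fun n => by simpa [φ] using hξne n
  choose a ha1 ha2 using fun n : ℕ =>
    (φ n).exists_small_of_not_homogeneous (hφ n) (hε n) (n : ℝ)
  have hη := hsum a ha1
  have hηn : ∀ n y, |y - (x + q n)| < q n / 8 → ∑' m, a m * χ m y = a n := by
    intro n y hy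
    rw [tsum_eq_single n, (χ n).one_of_mem_closedBall, mul_one]
    · rw [Metric.mem_closedBall, Real.dist_eq]; exact hy.le
    · intro m hm
      rw [(χ m).zero_of_le_dist, mul_zero]
      change q m / 4 ≤ _
      rw [Real.dist_eq]
      have h0 := abs_lt.1 hy
      have h1 := hq n
      have h2 := hq m
      rcases lt_or_gt_of_ne hm with h | h
      · have := hqlt h
        exact le_trans (by linarith) (neg_le_abs _)
      · have := hqlt h
        exact le_trans (by linarith) (le_abs_self _)
  let w : CkSpace k Ω := CkSpace.ofReal k Ω _ hη.contDiffOn * p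
  have hw : ∀ n, L w (ξ n) = φ n (a n) := by
    intro n
    refine hL _ _ _ ?_
    have : {y : ℝ | |y - (x + q n)| < q n / 8} ∈ 𝓝 (ξ n : ℝ) := by
      simpa [Metric.ball, Real.dist_eq, ξ] using
        Metric.ball_mem_nhds (x + q n : ℝ) (ε := q n / 8) (by have := hq n; positivity)
    filter_upwards [continuous_subtype_val.continuousAt.preimage_mem_nhds this] with y hy
    change (∑' m, a m * χ m y) * p.1 y = a n * p.1 y
    rw [hηn n y hy]
  have hlim : Tendsto (fun n => |L w (ξ n)|) atTop (𝓝 |L w x|) :=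
    (((L w).continuous.tendsto x).comp hξ).abs
  refine not_tendsto_nhds_of_tendsto_atTop ?_ _ hlim
  refine tendsto_atTop_mono (fun n => ?_) tendsto_natCast_atTop_atTop
  rw [hw]
  exact (ha2 n).le

/-! ### Additive local operators as differential operators. -/

/-- The function `y ↦ (y - a) ^ i` on `Ω`. -/
noncomputable def CkSpace.powSub (k : ℕ) (Ω : Set ℝ) (a : ℝ) (i : ℕ) : CkSpace k Ω :=
  CkSpace.ofReal k Ω (fun y => (y - a) ^ i) ((contDiff_id.sub contDiff_const).pow i).contDiffOn

/-- The coefficient at `x` is the operator applied to `(y - x)ⁱ / i!`. Recentring at the fixed point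
`0` makes its continuity in `x` visible, which is why `localCoeff` has its form. -/
theorem CkSpace.powSub_eq_sum (k : ℕ) (Ω : Set ℝ) (a : ℝ) (i : ℕ) :
    CkSpace.powSub k Ω a i =
      ∑ m ∈ Finset.range (i + 1), ((-a) ^ (i - m) * i.choose m) • CkSpace.powSub k Ω 0 m := by
  ext y
  simp [CkSpace.powSub, sub_eq_add_neg, add_pow, mul_comm, mul_left_comm]

theorem derivOrder_powSub {k : ℕ} {Ω : Set ℝ} (hΩ : IsOpen Ω) (x : Ω) (i j : ℕ) :
    derivOrder Ω j (CkSpace.powSub k Ω x i).1 x = if j = i then (i.factorial : ℝ) else 0 := by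
  have h : EqOn (extendZero Ω (CkSpace.powSub k Ω x i).1) (fun y => (y - (x : ℝ)) ^ i) Ω :=
    extendZero_eqOn (fun y => (y - (x : ℝ)) ^ i)
  rw [derivOrder, iteratedDerivWithin_congr h x.2, iteratedDerivWithin_of_isOpen hΩ x.2,
    iteratedDeriv_comp_sub_const (f := fun y : ℝ => y ^ i)]
  simp only [sub_self, iteratedDeriv_fun_pow_zero]
  by_cases h : j = i <;> simp [h]

theorem derivOrder_add {k : ℕ} {Ω : Set ℝ} (hΩ : IsOpen Ω) {i : ℕ} (hi : i ≤ k)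
    (u v : CkSpace k Ω) (x : Ω) :
    derivOrder Ω i (u + v).1 x = derivOrder Ω i u.1 x + derivOrder Ω i v.1 x := by
  have h : EqOn (extendZero Ω (u + v).1) (extendZero Ω u.1 + extendZero Ω v.1) Ω := by
    intro y hy
    have := fun w => extendZero_apply Ω w ⟨y, hy⟩
    simp only at this
    simp [this]
  have hle : ((i : ℕ) : WithTop ℕ∞) ≤ k := by exact_mod_cast hi
  rw [derivOrder, iteratedDerivWithin_congr h x.2, iteratedDerivWithin_add x.2 hΩ.uniqueDiffOn
    ((u.2 x x.2).of_le hle) ((v.2 x x.2).of_le hle)]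
  rfl

theorem derivOrder_smul {k : ℕ} {Ω : Set ℝ} {i : ℕ} (r : ℝ) (u : CkSpace k Ω) (x : Ω) :
    derivOrder Ω i (r • u).1 x = r * derivOrder Ω i u.1 x := by
  have h : EqOn (extendZero Ω (r • u).1) (r • extendZero Ω u.1) Ω := by
    intro y hy
    have := fun w => extendZero_apply Ω w ⟨y, hy⟩
    simp only at this
    simp [this]
  rw [derivOrder, iteratedDerivWithin_congr h x.2, iteratedDerivWithin_const_smul_field]
  rfl

/-- Differentiation of order `i ≤ k` at a point, as a linear functional on `𝒞ᵏ(Ω)`. -/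
noncomputable def derivOrderLinear {k : ℕ} {Ω : Set ℝ} (hΩ : IsOpen Ω) (i : Fin (k + 1)) (x : Ω) :
    CkSpace k Ω →ₗ[ℝ] ℝ where
  toFun u := derivOrder Ω i u.1 x
  map_add' u v := derivOrder_add hΩ (Nat.lt_succ_iff.1 i.2) u v x
  map_smul' r u := derivOrder_smul r u x

/-- The coefficient of the `i`-th derivative in the representation of an additive local
operator. -/
noncomputable def localCoeff {k : ℕ} {Ω : Set ℝ} (i : ℕ) :
    (CkSpace k Ω →+ C(Ω, ℝ)) →+ C(Ω, ℝ) :=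
  AddMonoidHom.mk' (fun L => ∑ m ∈ Finset.range (i + 1),
    (⟨fun x : Ω => (i.factorial : ℝ)⁻¹ * ((-(x : ℝ)) ^ (i - m) * i.choose m), by fun_prop⟩ :
      C(Ω, ℝ)) * L (CkSpace.powSub k Ω 0 m)) fun L L' => by
    simp [mul_add, Finset.sum_add_distrib]

/-- An additive local operator with continuous values is a linear differential operator with
continuous coefficients. -/
theorem IsLocalOp.eq_sum_derivOrder {k : ℕ} {Ω : Set ℝ} (hΩ : IsOpen Ω)
    (L : CkSpace k Ω →+ C(Ω, ℝ)) (hL : IsLocalOp L) (u : CkSpace k Ω) (x : Ω) :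
    L u x = ∑ i : Fin (k + 1), localCoeff i L x * derivOrder Ω i u.1 x := by
  let Lx : CkSpace k Ω →ₗ[ℝ] ℝ :=
    { toFun := fun v => L v x
      map_add' := fun v w => by rw [map_add, ContinuousMap.add_apply]
      map_smul' := fun r v => hL.homogeneous hΩ L r v x }
  have hcoeff : ∀ i : ℕ, localCoeff i L x = (i.factorial : ℝ)⁻¹ * Lx (CkSpace.powSub k Ω x i) := by
    intro i
    rw [CkSpace.powSub_eq_sum, map_sum]
    simp only [localCoeff, AddMonoidHom.mk'_apply, map_smul, smul_eq_mul, Finset.mul_sum,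
      ContinuousMap.sum_apply, ContinuousMap.mul_apply, ContinuousMap.coe_mk, mul_assoc]
    rfl
  -- The Taylor polynomial of `u` at `x`.
  let t : CkSpace k Ω := ∑ i : Fin (k + 1),
    (derivOrder Ω i u.1 x * ((i : ℕ).factorial : ℝ)⁻¹) • CkSpace.powSub k Ω x i
  have hjet : ∀ j ≤ k, derivOrder Ω j (u - t).1 x = 0 := by
    intro j hj
    have h : derivOrderLinear hΩ ⟨j, Nat.lt_succ_of_le hj⟩ x (u - t) = 0 := by
      rw [map_sub, map_sum, sub_eq_zero]
      rw [Finset.sum_eq_single ⟨j, Nat.lt_succ_of_le hj⟩]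
      · simp only [map_smul, derivOrderLinear, LinearMap.coe_mk, AddHom.coe_mk,
          derivOrder_powSub hΩ, if_true, smul_eq_mul]
        rw [mul_assoc, inv_mul_cancel₀ (by positivity), mul_one]
      · intro i _ hij
        have : j ≠ i := fun h => hij (Fin.ext h.symm)
        simp [derivOrderLinear, derivOrder_powSub hΩ, this]
      · simp
    exact h
  have h0 : Lx (u - t) = 0 := by
    have := hL.eq_of_jet_eq_zero hΩ (u - t) x hjet
    rwa [map_zero] at this
  have h1 : L u x = Lx t := by
    rw [map_sub, sub_eq_zero] at h0
    exact h0
  rw [h1, map_sum]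
  refine Finset.sum_congr rfl fun i _ => ?_
  rw [hcoeff, map_smul, smul_eq_mul]
  ring

/-! ### From the operator identity to additive operators. -/

/-- An operator satisfying the second-order Leibniz type identity is local. -/
theorem SatisfiesIdTwo.isLocalOp {k : ℕ} {Ω : Set ℝ} {D : CkSpace k Ω → C(Ω, ℝ)}
    (hD : SatisfiesIdTwo D) : IsLocalOp D := by
  intro u v x huv
  obtain ⟨ε, hε, h⟩ := Metric.eventually_nhds_iff.1 huv
  let b : ContDiffBump (x : ℝ) := ⟨ε / 2, ε, by positivity, by linarith⟩
  let g : CkSpace k Ω := CkSpace.ofReal k Ω b b.contDiff.contDiffOn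
  have hgx : g.1 x = 1 := b.one_of_mem_closedBall (Metric.mem_closedBall_self (by positivity))
  have hug : u * g = v * g := by
    ext y
    change u.1 y * b y = v.1 y * b y
    rcases lt_or_ge (dist y x) ε with hy | hy
    · rw [h hy]
    · rw [b.zero_of_le_dist hy, mul_zero, mul_zero]
  -- Apart from `D u x`, with coefficient `g(x)² = 1`, the identity involves `u` only through `u *
  -- g` and `u(x)`.
  have h1 := hD u g g x
  have h2 := hD v g g x
  rw [hug, huv.self_of_nhds, hgx] at h1
  rw [hgx] at h2
  linarith

/-- The exponential of a function in `𝒞ᵏ(Ω)`. -/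
noncomputable def CkSpace.exp {k : ℕ} {Ω : Set ℝ} (u : CkSpace k Ω) : CkSpace k Ω :=
  CkSpace.ofReal k Ω (fun y => Real.exp (extendZero Ω u.1 y))
    (Real.contDiff_exp.comp_contDiffOn u.2)

theorem CkSpace.exp_apply {k : ℕ} {Ω : Set ℝ} (u : CkSpace k Ω) (x : Ω) :
    (CkSpace.exp u).1 x = Real.exp (u.1 x) := by
  rw [CkSpace.exp, CkSpace.ofReal_apply, extendZero_apply]

theorem CkSpace.exp_add {k : ℕ} {Ω : Set ℝ} (u v : CkSpace k Ω) :
    CkSpace.exp (u + v) = CkSpace.exp u * CkSpace.exp v := by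
  ext x
  change (CkSpace.exp (u + v)).1 x = (CkSpace.exp u).1 x * (CkSpace.exp v).1 x
  simp only [CkSpace.exp_apply, ← Real.exp_add]
  rfl

/-- The logarithm of a positive function in `𝒞ᵏ(Ω)`. -/
noncomputable def CkPos.log {k : ℕ} {Ω : Set ℝ} (f : CkPos k Ω) : CkSpace k Ω :=
  ⟨fun y => Real.log (f.1.1 y), by
    refine (ContDiffOn.log f.1.2 fun y hy => ?_).congr
      fun y hy => (extendZero_apply Ω _ ⟨y, hy⟩).trans ?_
    · rw [extendZero_apply Ω f.1.1 ⟨y, hy⟩]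
      exact (f.2 ⟨y, hy⟩).ne'
    · rw [← extendZero_apply Ω f.1.1 ⟨y, hy⟩]⟩

theorem CkPos.exp_log {k : ℕ} {Ω : Set ℝ} (f : CkPos k Ω) : CkSpace.exp (CkPos.log f) = f.1 := by
  ext x
  rw [CkSpace.exp_apply]
  exact Real.exp_log (f.2 x)

theorem CkPos.log_mul {k : ℕ} {Ω : Set ℝ} (f g : CkPos k Ω) :
    CkPos.log (f * g) = CkPos.log f + CkPos.log g := by
  ext x
  exact Real.log_mul (f.2 x).ne' (g.2 x).ne'

theorem CkSpace.continuous {k : ℕ} {Ω : Set ℝ} (u : CkSpace k Ω) : Continuous u.1 := by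
  have := u.2.continuousOn.domRestrict
  refine this.congr fun x => ?_
  rw [domRestrict_apply, extendZero_apply]

theorem continuous_derivOrder {k : ℕ} {Ω : Set ℝ} (hΩ : IsOpen Ω) {i : ℕ} (hi : i ≤ k)
    (u : CkSpace k Ω) : Continuous (derivOrder Ω i u.1) :=
  (u.2.continuousOn_iteratedDerivWithin (by exact_mod_cast hi) hΩ.uniqueDiffOn).domRestrict

/-- A function whose third-order differences at the origin vanish is the sum of an additive
function and the diagonal of a biadditive one. -/
theorem exists_additive_add_biadditive {E M : Type*} [AddCommGroup E] [AddCommGroup M]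
    [Module ℝ M] (A : E → M)
    (hA : ∀ u v w, A (u + v + w) - A (v + w) - A (u + w) - A (u + v) + A w + A v + A u = 0) :
    ∃ (L : E →+ M) (Q : E →+ E →+ M), (∀ u, A u = L u + Q u u) ∧
      ∀ u v, Q u v = (1 / 2 : ℝ) • (A (u + v) - A u - A v) := by
  -- Polarization: vanishing third differences amount to additivity of `q` in its second argument.
  let q : E → E → M := fun u v => (1 / 2 : ℝ) • (A (u + v) - A u - A v)
  have hqc : ∀ u v, q u v = q v u := fun u v => by
    simp only [q, add_comm u v]
    module
  have hqr : ∀ u v w, q u (v + w) = q u v + q u w := fun u v w => by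
    have h := hA u v w
    simp only [q, ← add_assoc]
    linear_combination (norm := module) (1 / 2 : ℝ) • h
  have hql : ∀ u v w, q (u + v) w = q u w + q v w := fun u v w => by
    rw [hqc, hqr, hqc w u, hqc w v]
  have hAq : ∀ u v, A (u + v) = A u + A v + (2 : ℝ) • q u v := fun u v => by
    simp only [q]
    module
  refine ⟨AddMonoidHom.mk' (fun u => A u - q u u) fun u v => ?_,
    AddMonoidHom.mk' (fun u => AddMonoidHom.mk' (q u) (hqr u)) fun u v => ?_, fun u => ?_,
    fun u v => rfl⟩
  · rw [hAq, hql, hqr, hqr, hqc v u]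
    module
  · ext w
    exact hql u v w
  · simp

/-- Lets the representation be applied again, to the coefficients of `N u` as functions of `u`. -/
theorem isLocalOp_localCoeff {k : ℕ} {Ω : Set ℝ} {N : CkSpace k Ω →+ CkSpace k Ω →+ C(Ω, ℝ)}
    (hN : ∀ v, IsLocalOp fun u => N u v) (i : ℕ) :
    IsLocalOp fun u => localCoeff i (N u) := by
  intro u u' x h
  simp only [localCoeff, AddMonoidHom.mk'_apply, ContinuousMap.sum_apply, ContinuousMap.mul_apply]
  exact Finset.sum_congr rfl fun m _ => congrArg _ (hN _ u u' x h)

/-! ### The two halves of the theorem. -/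

/-- An operator satisfying the identity is given on positive functions by a polynomial of degree
two in the derivatives of the logarithm. -/
theorem SatisfiesIdTwo.exists_logForm {k : ℕ} {Ω : Set ℝ} (hΩ : IsOpen Ω)
    {D : CkSpace k Ω → C(Ω, ℝ)} (hD : SatisfiesIdTwo D) :
    ∃ (c : Fin (k + 1) → C(Ω, ℝ)) (d : Fin (k + 1) → Fin (k + 1) → C(Ω, ℝ)),
      ∀ f ∈ CkPos k Ω, ∀ x : Ω, D f x = logForm c d f.1 x := by
  let A : CkSpace k Ω → C(Ω, ℝ) := fun u =>
    ⟨fun x => Real.exp (-u.1 x), Real.continuous_exp.comp (CkSpace.continuous u).neg⟩ *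
      D (CkSpace.exp u)
  have hDA : ∀ u x, D (CkSpace.exp u) x = Real.exp (u.1 x) * A u x := fun u x => by
    change _ = _ * (Real.exp (-u.1 x) * D (CkSpace.exp u) x)
    rw [← mul_assoc, ← Real.exp_add, add_neg_cancel, Real.exp_zero, one_mul]
  have hAloc : IsLocalOp A := fun u v x h => by
    change Real.exp (-u.1 x) * D (CkSpace.exp u) x = Real.exp (-v.1 x) * D (CkSpace.exp v) x
    rw [h.self_of_nhds, hD.isLocalOp (CkSpace.exp u) (CkSpace.exp v) x (h.mono fun y hy => by
      rw [CkSpace.exp_apply, CkSpace.exp_apply, hy])]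
  have hA : ∀ u v w,
      A (u + v + w) - A (v + w) - A (u + w) - A (u + v) + A w + A v + A u = 0 := by
    intro u v w
    ext x
    have h := hD (CkSpace.exp u) (CkSpace.exp v) (CkSpace.exp w) x
    simp only [← CkSpace.exp_add, hDA, CkSpace.exp_apply] at h
    have hadd : ∀ s t : CkSpace k Ω, (s + t).1 x = s.1 x + t.1 x := fun _ _ => rfl
    simp only [hadd, Real.exp_add] at h
    refine mul_left_cancel₀ (mul_ne_zero (mul_ne_zero (Real.exp_ne_zero (u.1 x))
      (Real.exp_ne_zero (v.1 x))) (Real.exp_ne_zero (w.1 x))) ?_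
    simp only [ContinuousMap.add_apply, ContinuousMap.sub_apply, ContinuousMap.zero_apply]
    linear_combination h
  obtain ⟨L, Q, hLQ, hQ⟩ := exists_additive_add_biadditive A hA
  have hQ_symm : ∀ u v, Q u v = Q v u := fun u v => by
    rw [hQ, hQ, add_comm u v, sub_right_comm]
  have hQr : ∀ u, IsLocalOp (Q u) := fun u v w x h => by
    simp only [hQ, ContinuousMap.smul_apply, ContinuousMap.sub_apply]
    rw [hAloc v w x h, hAloc (u + v) (u + w) x (h.mono fun y hy => congrArg (u.1 y + ·) hy)]
  have hQl : ∀ v, IsLocalOp fun u => Q u v := fun v => by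
    simpa only [hQ_symm _ v] using hQr v
  have hLloc : IsLocalOp L := fun u v x h => by
    have hL : ∀ w, L w x = A w x - Q w w x := fun w => by
      rw [hLQ, ContinuousMap.add_apply, add_sub_cancel_right]
    rw [hL, hL, hAloc u v x h, hQr u u v x h]
    exact congrArg _ (hQl v u v x h)
  have hM := fun j : ℕ => isLocalOp_localCoeff hQl j
  refine ⟨fun i => localCoeff i L, fun i j => localCoeff i ((localCoeff j).comp Q),
    fun f hf x => ?_⟩
  have hlog : (fun y => Real.log (f.1 y)) = (CkPos.log ⟨f, hf⟩).1 := rfl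
  have hDf : D f x = f.1 x * A (CkPos.log ⟨f, hf⟩) x := by
    have := hDA (CkPos.log ⟨f, hf⟩) x
    rwa [← CkSpace.exp_apply, CkPos.exp_log] at this
  -- `Q u` is expanded in its argument first; its `j`-th coefficient, additive and local in `u`, is
  -- expanded last.
  rw [logForm, hlog, hDf, hLQ, ContinuousMap.add_apply, hLloc.eq_sum_derivOrder hΩ,
    (hQr _).eq_sum_derivOrder hΩ, Finset.sum_comm]
  congr 2
  refine Finset.sum_congr rfl fun j _ => ?_
  rw [← Finset.sum_mul]
  congr 1
  exact IsLocalOp.eq_sum_derivOrder hΩ ((localCoeff j).comp Q) (hM j) _ x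

/-- Every choice of continuous coefficients defines an operator satisfying the identity. -/
theorem exists_satisfiesIdTwoPos {k : ℕ} {Ω : Set ℝ} (hΩ : IsOpen Ω) (c : Fin (k + 1) → C(Ω, ℝ))
    (d : Fin (k + 1) → Fin (k + 1) → C(Ω, ℝ)) :
    ∃ D : CkPos k Ω → C(Ω, ℝ),
      (∀ (f : CkPos k Ω) (x : Ω), D f x = logForm c d f.1.1 x) ∧ SatisfiesIdTwoPos D := by
  have hform : ∀ (f : CkPos k Ω) (x : Ω), logForm c d f.1.1 x =
      f.1.1 x * (∑ i, c i x * derivOrder Ω i (CkPos.log f).1 x + ∑ i, ∑ j, d i j x *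
        derivOrder Ω i (CkPos.log f).1 x * derivOrder Ω j (CkPos.log f).1 x) := fun _ _ => rfl
  have hcont : ∀ f : CkPos k Ω, Continuous (logForm c d f.1.1) := by
    intro f
    have h : ∀ i : Fin (k + 1), Continuous (derivOrder Ω i (CkPos.log f).1) := fun i =>
      continuous_derivOrder hΩ (Nat.lt_succ_iff.1 i.2) (CkPos.log f)
    have h0 := CkSpace.continuous f.1
    refine Continuous.congr ?_ fun x => (hform f x).symm
    fun_prop
  refine ⟨fun f => ⟨logForm c d f.1.1, hcont f⟩, fun _ _ => rfl, fun f g h x => ?_⟩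
  have hadd : ∀ (i : Fin (k + 1)) (u v : CkSpace k Ω), derivOrder Ω i (u + v).1 x =
      derivOrder Ω i u.1 x + derivOrder Ω i v.1 x := fun i u v =>
    derivOrder_add hΩ (Nat.lt_succ_iff.1 i.2) u v x
  have hmul : ∀ p q : CkPos k Ω, (p * q).1.1 x = p.1.1 x * q.1.1 x := fun _ _ => rfl
  simp only [ContinuousMap.coe_mk, hform, CkPos.log_mul, hadd, hmul, mul_add, add_mul,
    Finset.sum_add_distrib]
  ring

theorem mainTheorem4 (k : ℕ) (Ω : Set ℝ) (hΩ : IsOpen Ω) (hne : Ω.Nonempty) :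
    (∀ D : CkSpace k Ω → C(Ω, ℝ), SatisfiesIdTwo D →
      ∃ (c : Fin (k + 1) → C(Ω, ℝ)) (d : Fin (k + 1) → Fin (k + 1) → C(Ω, ℝ)),
        ∀ f ∈ CkPos k Ω, ∀ x : Ω, D f x = logForm c d f.1 x) ∧
    (∀ (c : Fin (k + 1) → C(Ω, ℝ)) (d : Fin (k + 1) → Fin (k + 1) → C(Ω, ℝ)),
      ∃ D : CkPos k Ω → C(Ω, ℝ),
        (∀ (f : CkPos k Ω) (x : Ω), D f x = logForm c d f.1.1 x) ∧ SatisfiesIdTwoPos D) :=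
  ⟨fun _ hD => hD.exists_logForm hΩ, exists_satisfiesIdTwoPos hΩ⟩
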